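/- Time is slotted. In every slot a data packet arrives with probability $\lambda_1\in(0,1]$ and an actuation opportunity occurs with probability $\lambda_2\in(0,1]$; all these events are independent, within and between slots. An actuation consumes one packet, and the packet used may be one that arrives in the same slot. The Age of Actuation (AoA) $A(n)\in\{1,2,\dots\}$ at the end of slot $n$ equals $1$ if an actuation takes place in slot $n$ and $A(n-1)+1$ otherwise. Consider three systems. (a) *Geo/Geo/1 with a controller*: packets are stored in an infinite queue; there is an actuation in slot $n$ if and only if an opportunity (a permission of the controller) occurs and the queue is nonempty or a packet arrives. The actuated packet is the oldest one (FCFS), or the newest one, including a packet that arrives in the slot (LCFS with preemption). $Q(n)\in\{0,1,2,\dots\}$ is the number of packets in the queue at the end of slot $n$. (b) *Geo/Geo/1/1 with a controller*: the same, except that at most one packet is stored: a new packet replaces a stored one. $Q(n)\in\{0,1\}$. (c) *Geo/Geo/1/1 with a battery*: the buffer is as in (b); an opportunity is the harvesting of one energy unit, and a battery stores at most one unit. There is an actuation if and only if a packet (stored or new) and an energy unit (stored or newly harvested) are available; it uses the packet and one energy unit. If the battery is full before the slot of an actuation and a unit is harvested in that slot, the battery is full at the end of it. $B(n)\in\{0,1\}$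 is the battery level at the end of slot $n$. **Theorem.** Let $\bar A$ denote the value given below. In each case, the Markov chain $(A,Q)$ in (a) and (b), respectively $(A,Q,B)$ in (c), has a unique stationary distribution, the expectation of the AoA under it is $\bar A$, and from every initial state of the system (in (a): of the AoA and the queue contents) the long-run average $\frac1N\sum_{n<N}\mathbb E[A(n)]$ converges to $\bar A$ as $N\to\infty$. (i) In (a), if $\lambda_1<\lambda_2$ (stability), then under either policy, FCFS or LCFS, the process $(A,Q)$ is the same Markov chain, and $$\bar A=\frac1{\lambda_1}.$$ (ii) In (b), $$\bar A=\frac{(\lambda_2-1)(\lambda_1^2+\lambda_1\lambda_2)-\lambda_2^2}{\lambda_1\lambda_2\left(\lambda_1(\lambda_2-1)-\lambda_2\right)}.$$ (iii) In (c), if $\lambda_1$ and $\lambda_2$ are not both equal to $1$, $$\bar A=\frac{\lambda_1^4(\lambda_2-1)^3-2\lambda_1^3\lambda_2(\lambda_2-1)^2-\lambda_1^2\lambda_2^2(2\lambda_2^2-3\lambda_2+1)+\lambda_1\lambda_2^3(3\lambda_2-2)-\lambda_2^4}{\lambda_1\lambda_2\left(\lambda_1(\lambda_2-1)-\lambda_2\right)\left(\lambda_1^2(\lambda_2-1)^2+\lambda_1(-2\lambda_2^2+\lambda_2)+\lambda_2^2\right)}.$$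 -/

import Mathlib

open scoped ENNReal Topology

noncomputable section

namespace AgeOfActuation

/-- The Bernoulli law on `Bool`, with probability `p` of `true`. -/
def coin (p : unitInterval) : PMF Bool :=
  PMF.ofFintype (fun b => if b then ENNReal.ofReal (p : ℝ) else ENNReal.ofReal (1 - (p : ℝ))) (by
    have h0 : 0 ≤ (p : ℝ) := p.2.1
    have h1 : 0 ≤ 1 - (p : ℝ) := sub_nonneg.2 p.2.2
    simp [← ENNReal.ofReal_add h0 h1])

/-- What happens in one time slot: `arrival` is the event that a data packet is received,
`opportunity` is the event that the controller gives a permission (or, in the system with a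
battery, that an energy unit is harvested). -/
structure Slot where
  arrival : Bool
  opportunity : Bool

/-- The law of one slot: independent events, of probabilities `l₁` and `l₂`. -/
def slotLaw (l₁ l₂ : unitInterval) : PMF Slot :=
  (coin l₁).bind fun a => (coin l₂).map fun o => ⟨a, o⟩

section Chains

variable {S : Type}

/-- The Markov kernel on `S` of a system whose state at the end of a slot is `step s e`, where `s` is
the state at the end of the previous slot and `e` is the outcome of the slot; the outcomes of
different slots are independent and identically distributed. -/
def kernel (l₁ l₂ : unitInterval) (step : S → Slot → S) (s : S) : PMF S :=
  (slotLaw l₁ l₂).map (step s)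

/-- The law of the state at the end of slot `n`, from the initial state `s`. -/
def lawAt (K : S → PMF S) (s : S) : ℕ → PMF S
  | 0 => PMF.pure s
  | n + 1 => (lawAt K s n).bind K

/-- `π` is a stationary distribution of the Markov chain with kernel `K`. -/
def IsStationary (K : S → PMF S) (π : PMF S) : Prop := π.bind K = π

/-- The expectation of a positive integer valued function (possibly infinite). -/
def mean (μ : PMF S) (f : S → ℕ+) : ℝ≥0∞ := ∑' s, μ s * ((f s : ℕ) : ℝ≥0∞)

/-- From every initial state, the long-run time average of the expectation of `f` is `v`. -/
def HasLongRunAverage (K : S → PMF S) (f : S → ℕ+) (v : ℝ≥0∞) : Prop :=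
  ∀ s : S, Filter.Tendsto
    (fun N : ℕ => (∑ n ∈ Finset.range N, mean (lawAt K s n) f) / (N : ℝ≥0∞)) Filter.atTop (𝓝 v)

/-- The chain has exactly one stationary distribution, and the expectation of `f` under it is
`v`. -/
def HasStationaryAverage (K : S → PMF S) (f : S → ℕ+) (v : ℝ≥0∞) : Prop :=
  (∃! π : PMF S, IsStationary K π) ∧ ∀ π : PMF S, IsStationary K π → mean π f = v

end Chains

/-- Evolution of the age of actuation: it is reset to `1` by an actuation and otherwise it increases
by `1`. -/
def nextAge (A : ℕ+) (actuation : Bool) : ℕ+ := if actuation then 1 else A + 1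

/-! ### Infinite queue with a controller -/

/-- State: age of actuation, and number of packets in the queue, at the end of a slot. -/
structure QueueState where
  age : ℕ+
  length : ℕ

/-- One slot of the infinite queue with a controller, in terms of the number of packets. -/
def queueStep (s : QueueState) (e : Slot) : QueueState :=
  let actuation : Bool := e.opportunity && (decide (s.length ≠ 0) || e.arrival)
  { age := nextAge s.age actuation
    length := s.length + (if e.arrival then 1 else 0) - (if actuation then 1 else 0) }

/-- The two queueing disciplines: first-come first-served, and last-come first-served with
preemption (a new packet has priority already in its arrival slot). -/
inductive Policy where
  | fcfs
  | lcfs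

/-- The packets that remain after the packet chosen by the discipline has been actuated; packets are
listed in the order of their arrival. -/
def Policy.serve : Policy → List ℕ → List ℕ
  | .fcfs, q => q.tail
  | .lcfs, q => q.dropLast

/-- State: age of actuation, and the ages of all the packets in the queue, listed in the order of
their arrival, at the end of a slot. -/
structure PacketState where
  age : ℕ+
  packets : List ℕ

/-- The number of packets that are in the queue, next to the age of actuation. -/
def PacketState.count (s : PacketState) : QueueState := ⟨s.age, s.packets.length⟩

/-- One slot of the infinite queue with a controller, packet by packet. Stored packets get older by
`1`; a packet that arrives in the slot has age `1` at the end of it. -/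
def packetStep (p : Policy) (s : PacketState) (e : Slot) : PacketState :=
  let available : List ℕ := s.packets.map (· + 1) ++ (if e.arrival then [1] else [])
  let actuation : Bool := e.opportunity && !available.isEmpty
  { age := nextAge s.age actuation
    packets := if actuation then p.serve available else available }

/-! ### Single-packet buffer with a controller -/

/-- State: age of actuation, and whether the buffer holds a packet, at the end of a slot. -/
structure BufferState where
  age : ℕ+
  full : Bool

/-- One slot of the single-packet buffer with a controller. A new packet replaces a stored one, and
an actuation empties the buffer. -/
def bufferStep (s : BufferState) (e : Slot) : BufferState :=
  let packet : Bool := s.full || e.arrival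
  let actuation : Bool := e.opportunity && packet
  { age := nextAge s.age actuation
    full := packet && !actuation }

/-! ### Single-packet buffer with a unit battery -/

/-- State: age of actuation, whether the buffer holds a packet, and whether the battery holds an
energy unit, at the end of a slot. -/
structure BatteryState where
  age : ℕ+
  full : Bool
  charged : Bool

/-- One slot of the single-packet buffer with a battery of size one. There is an actuation when a
packet (stored or new) and an energy unit (stored or newly harvested) are available; it uses
the packet and one energy unit. If the battery was charged and a unit is harvested in the slot of
an actuation, then the battery is charged at the end of the slot; a unit harvested when the battery
is charged and there is no actuation is lost. -/
def batteryStep (s : BatteryState) (e : Slot) : BatteryState :=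
  let packet : Bool := s.full || e.arrival
  let energy : Bool := s.charged || e.opportunity
  let actuation : Bool := energy && packet
  { age := nextAge s.age actuation
    full := packet && !actuation
    charged := if actuation then s.charged && e.opportunity else energy }

end AgeOfActuation

end

/-!
In each system the age `A` of actuation grows by at most `1` per slot and is reset by every slot
with both an arrival and an opportunity (`IsAge`). Hence the expectation of `A` stays bounded and
`A²` has a bounded drift.

The averages come from the Poisson equation `h + v = A + P h`, where `P` is the averaging operator
of one slot. Summed along the chain, it gives `∑_{n < N} E A(n) = N v + h - E h(N)`, and
`(E h(N))² ≤ E h(N)²` grows at most linearly in `N` because `A²`, like the square of the length of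
a stable queue, has a bounded drift (`hasLongRunAverage_of_poisson`). A slot has four outcomes, so
`P` is a finite sum and all of this takes place in `ℝ`. In all three systems `h` is explicit: it is
affine in the age, the coefficient of the age being the mean time until the next actuation.

For the two systems with a single-packet buffer there is a word of slots that leads to the same
state from everywhere. This gives a Doeblin minorization, hence a unique stationary distribution
(`existsUnique_isStationary_of_word`). Integrating the Poisson equation against it gives the
stationary mean (`IsAge.mean_eq_of_poisson`), because the age is integrable
(`IsAge.expect_ne_top`).

For the infinite queue the stationary distribution is the product of two geometric laws
(`isStationary_productLaw`): as in Burke's theorem, the past actuations form in equilibrium a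
Bernoulli process of rate `l₁` that is independent of the present queue length. It is unique because
the empty queue can be reached from everywhere (`IsStationary.unique_of_accessible`). The packets
enter only through their number, which evolves in the same way under both disciplines
(`count_packetStep`).
-/

namespace AgeOfActuation

variable {S T : Type} {l₁ l₂ : unitInterval} {step : S → Slot → S}

/-! ### Expectations of nonnegative functions -/

/-- The expectation of a `[0, ∞]`-valued function. -/
noncomputable def expect (μ : PMF S) (g : S → ℝ≥0∞) : ℝ≥0∞ := ∑' s, μ s * g s

theorem mean_eq_expect (μ : PMF S) (f : S → ℕ+) :
    mean μ f = expect μ fun s => ENNReal.ofReal ((f s : ℕ) : ℝ) := by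
  simp [mean, expect]

theorem expect_pure (s : S) (g : S → ℝ≥0∞) : expect (PMF.pure s) g = g s := by
  unfold expect
  rw [tsum_eq_single s]
  · simp
  · intro t ht
    simp [PMF.pure_apply, ht]

theorem expect_bind (μ : PMF S) (K : S → PMF T) (g : T → ℝ≥0∞) :
    expect (μ.bind K) g = expect μ fun s => expect (K s) g := by
  simp only [expect, PMF.bind_apply, ← ENNReal.tsum_mul_right, ← ENNReal.tsum_mul_left, mul_assoc]
  exact ENNReal.tsum_comm

theorem expect_map (μ : PMF S) (φ : S → T) (g : T → ℝ≥0∞) :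
    expect (μ.map φ) g = expect μ fun s => g (φ s) := by
  rw [← PMF.bind_pure_comp, expect_bind]
  simp [expect_pure]

theorem expect_mono (μ : PMF S) {g g' : S → ℝ≥0∞} (h : ∀ s, g s ≤ g' s) :
    expect μ g ≤ expect μ g' :=
  ENNReal.tsum_le_tsum fun s => mul_le_mul_right (h s) _

theorem expect_add (μ : PMF S) (g g' : S → ℝ≥0∞) :
    (expect μ fun s => g s + g' s) = expect μ g + expect μ g' := by
  simp only [expect, mul_add, ENNReal.tsum_add]

theorem expect_const (μ : PMF S) (c : ℝ≥0∞) : (expect μ fun _ => c) = c := by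
  simp [expect, ENNReal.tsum_mul_right, PMF.tsum_coe]

theorem expect_const_mul (μ : PMF S) (c : ℝ≥0∞) (g : S → ℝ≥0∞) :
    (expect μ fun s => c * g s) = c * expect μ g := by
  simp only [expect, ← ENNReal.tsum_mul_left, mul_left_comm]

/-! ### One slot as an averaging operator on functions -/

theorem slotLaw_apply (l₁ l₂ : unitInterval) (a o : Bool) :
    slotLaw l₁ l₂ ⟨a, o⟩ = coin l₁ a * coin l₂ o := by
  cases a <;> cases o <;> simp [slotLaw, PMF.bind_apply, PMF.map_apply]

theorem coin_true (p : unitInterval) : coin p true = ENNReal.ofReal (p : ℝ) := rfl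

theorem coin_false (p : unitInterval) : coin p false = ENNReal.ofReal (1 - (p : ℝ)) := rfl

/-- The averaging operator of a slot on real functions: `transfer l₁ l₂ step f s` is the expectation
of `f` one slot after the state `s`. It is a sum over the four outcomes of a slot, so that no
summability is involved, even for unbounded `f`. -/
def transfer (l₁ l₂ : unitInterval) (step : S → Slot → S) : (S → ℝ) →ₗ[ℝ] (S → ℝ) where
  toFun f s := (l₁ : ℝ) * l₂ * f (step s ⟨true, true⟩)
    + (l₁ : ℝ) * (1 - l₂) * f (step s ⟨true, false⟩)
    + (1 - (l₁ : ℝ)) * l₂ * f (step s ⟨false, true⟩)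
    + (1 - (l₁ : ℝ)) * (1 - l₂) * f (step s ⟨false, false⟩)
  map_add' f g := by ext s; simp only [Pi.add_apply]; ring
  map_smul' c f := by ext s; simp only [Pi.smul_apply, smul_eq_mul, RingHom.id_apply]; ring

theorem transfer_apply (f : S → ℝ) (s : S) :
    transfer l₁ l₂ step f s = (l₁ : ℝ) * l₂ * f (step s ⟨true, true⟩)
    + (l₁ : ℝ) * (1 - l₂) * f (step s ⟨true, false⟩)
    + (1 - (l₁ : ℝ)) * l₂ * f (step s ⟨false, true⟩)
    + (1 - (l₁ : ℝ)) * (1 - l₂) * f (step s ⟨false, false⟩) := rfl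

theorem transfer_mono {f g : S → ℝ} (h : f ≤ g) :
    transfer l₁ l₂ step f ≤ transfer l₁ l₂ step g := by
  intro s
  have a1 : 0 ≤ (l₁ : ℝ) := l₁.2.1
  have a2 : 0 ≤ (l₂ : ℝ) := l₂.2.1
  have b1 : 0 ≤ 1 - (l₁ : ℝ) := sub_nonneg.2 l₁.2.2
  have b2 : 0 ≤ 1 - (l₂ : ℝ) := sub_nonneg.2 l₂.2.2
  simp only [transfer_apply]
  gcongr <;> exact h _

theorem transfer_one : transfer l₁ l₂ step (1 : S → ℝ) = 1 := by
  ext s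
  simp only [transfer_apply, Pi.one_apply]
  ring

theorem transfer_nonneg {f : S → ℝ} (h : 0 ≤ f) : 0 ≤ transfer l₁ l₂ step f := by
  simpa using transfer_mono (l₁ := l₁) (l₂ := l₂) (step := step) h

theorem transfer_pow_mono (n : ℕ) {f g : S → ℝ} (h : f ≤ g) :
    (transfer l₁ l₂ step ^ n) f ≤ (transfer l₁ l₂ step ^ n) g := by
  induction n with
  | zero => simpa using h
  | succ n ih => simpa only [pow_succ', Module.End.mul_apply] using transfer_mono ih

theorem transfer_pow_one (n : ℕ) : (transfer l₁ l₂ step ^ n) (1 : S → ℝ) = 1 := by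
  induction n with
  | zero => simp
  | succ n ih => rw [pow_succ', Module.End.mul_apply, ih, transfer_one]

/-- Jensen's inequality for the square and the law after `n` slots. -/
theorem sq_transfer_pow_le (n : ℕ) (h : S → ℝ) (s : S) :
    (transfer l₁ l₂ step ^ n) h s ^ 2 ≤ (transfer l₁ l₂ step ^ n) (h ^ 2) s := by
  set c := (transfer l₁ l₂ step ^ n) h s with hc
  have h0 : (0 : S → ℝ) ≤ h ^ 2 - (2 * c) • h + c ^ 2 • (1 : S → ℝ) := by
    intro t
    simp only [Pi.zero_apply, Pi.add_apply, Pi.sub_apply, Pi.smul_apply, Pi.pow_apply,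
      smul_eq_mul, Pi.one_apply]
    nlinarith [sq_nonneg (h t - c)]
  have h1 := transfer_pow_mono (l₁ := l₁) (l₂ := l₂) (step := step) n h0 s
  rw [map_zero, map_add, map_sub, map_smul, map_smul, transfer_pow_one] at h1
  simp only [Pi.zero_apply, Pi.add_apply, Pi.sub_apply, Pi.smul_apply, smul_eq_mul, Pi.one_apply,
    ← hc] at h1
  nlinarith

theorem expect_kernel {f : S → ℝ} (hf : 0 ≤ f) (s : S) :
    (expect (kernel l₁ l₂ step s) fun t => ENNReal.ofReal (f t)) =
      ENNReal.ofReal (transfer l₁ l₂ step f s) := by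
  have a1 : 0 ≤ (l₁ : ℝ) := l₁.2.1
  have a2 : 0 ≤ (l₂ : ℝ) := l₂.2.1
  have b1 : 0 ≤ 1 - (l₁ : ℝ) := sub_nonneg.2 l₁.2.2
  have b2 : 0 ≤ 1 - (l₂ : ℝ) := sub_nonneg.2 l₂.2.2
  have hf' : ∀ t, 0 ≤ f t := hf
  rw [kernel, expect_map, slotLaw, expect_bind]
  simp only [expect_map]
  simp only [expect, tsum_bool, coin_true, coin_false]
  rw [transfer_apply]
  simp only [← ENNReal.ofReal_mul a2, ← ENNReal.ofReal_mul b2]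
  rw [← ENNReal.ofReal_add, ← ENNReal.ofReal_add, ← ENNReal.ofReal_mul b1,
    ← ENNReal.ofReal_mul a1, ← ENNReal.ofReal_add]
  · congr 1; ring
  all_goals
    have := hf' (step s ⟨true, true⟩)
    have := hf' (step s ⟨true, false⟩)
    have := hf' (step s ⟨false, true⟩)
    have := hf' (step s ⟨false, false⟩)
    positivity

theorem expect_lawAt {f : S → ℝ} (hf : 0 ≤ f) (s : S) (n : ℕ) :
    (expect (lawAt (kernel l₁ l₂ step) s n) fun t => ENNReal.ofReal (f t)) =
      ENNReal.ofReal ((transfer l₁ l₂ step ^ n) f s) := by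
  induction n generalizing f with
  | zero => simp [lawAt, expect_pure]
  | succ n ih =>
    simp only [lawAt, expect_bind, expect_kernel hf]
    rw [ih (transfer_nonneg hf), pow_succ, Module.End.mul_apply]

/-- A stationary law gives a function and its average over the next slot the same expectation. -/
theorem IsStationary.expect_transfer {π : PMF S} (hπ : IsStationary (kernel l₁ l₂ step) π)
    {f : S → ℝ} (hf : 0 ≤ f) :
    (expect π fun s => ENNReal.ofReal (transfer l₁ l₂ step f s)) =
      expect π fun s => ENNReal.ofReal (f s) := by
  conv_rhs => rw [← show π.bind (kernel l₁ l₂ step) = π from hπ, expect_bind]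
  simp only [expect_kernel hf]

/-! ### Averages from a Poisson equation -/

/-- The real-valued version of a positive integer valued function. -/
def toRealFun (f : S → ℕ+) : S → ℝ := fun s => ((f s : ℕ) : ℝ)

theorem toRealFun_nonneg (f : S → ℕ+) : 0 ≤ toRealFun f := fun _ => Nat.cast_nonneg _

theorem one_le_toRealFun (f : S → ℕ+) (s : S) : 1 ≤ toRealFun f s :=
  Nat.one_le_cast.2 (f s).2

/-- A solution `h` of the Poisson equation telescopes the sum of the expectations of `f`. -/
theorem sum_transfer_pow_eq {f h : S → ℝ} {v : ℝ}
    (hP : ∀ s, h s + v = f s + transfer l₁ l₂ step h s) (s : S) (N : ℕ) :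
    ∑ n ∈ Finset.range N, (transfer l₁ l₂ step ^ n) f s =
      N * v + h s - (transfer l₁ l₂ step ^ N) h s := by
  have hfun : f = h + v • (1 : S → ℝ) - transfer l₁ l₂ step h := by
    ext t
    simp only [Pi.add_apply, Pi.sub_apply, Pi.smul_apply, smul_eq_mul, Pi.one_apply]
    linarith [hP t]
  induction N with
  | zero => simp
  | succ N ih =>
    rw [Finset.sum_range_succ, ih]
    have h1 : (transfer l₁ l₂ step ^ N) f s =
        (transfer l₁ l₂ step ^ N) h s + v - (transfer l₁ l₂ step ^ (N + 1)) h s := by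
      rw [pow_succ, Module.End.mul_apply]
      conv_lhs => rw [hfun, map_sub, map_add, map_smul, transfer_pow_one]
      simp
    rw [h1]
    push_cast
    ring

theorem transfer_pow_le_of_drift {V : S → ℝ} {c : ℝ}
    (hV : ∀ s, transfer l₁ l₂ step V s ≤ V s + c) (s : S) (N : ℕ) :
    (transfer l₁ l₂ step ^ N) V s ≤ V s + N * c := by
  induction N with
  | zero => simp
  | succ N ih =>
    have h1 : transfer l₁ l₂ step V ≤ V + c • (1 : S → ℝ) := fun t => by simpa using hV t
    have h2 := transfer_pow_mono (l₁ := l₁) (l₂ := l₂) (step := step) N h1 s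
    rw [map_add, map_smul, transfer_pow_one] at h2
    simp only [Pi.add_apply, Pi.smul_apply, smul_eq_mul, Pi.one_apply] at h2
    rw [pow_succ, Module.End.mul_apply]
    push_cast
    linarith

/-- If `f` has a solution `h` of the Poisson equation whose square is dominated by a function that
grows at most linearly in expectation, then the boundary term of the telescoping sum has the order
of `√N` and the time averages of the expectations converge. -/
theorem tendsto_average_of_poisson {f h V : S → ℝ} {v c : ℝ}
    (hP : ∀ s, h s + v = f s + transfer l₁ l₂ step h s)
    (hhV : ∀ s, h s ^ 2 ≤ V s)
    (hV : ∀ s, transfer l₁ l₂ step V s ≤ V s + c) (s : S) :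
    Filter.Tendsto
      (fun N : ℕ => (∑ n ∈ Finset.range N, (transfer l₁ l₂ step ^ n) f s) / (N : ℝ))
      Filter.atTop (𝓝 v) := by
  have hsq : ∀ N : ℕ, (transfer l₁ l₂ step ^ N) h s ^ 2 ≤ V s + N * c := fun N =>
    (sq_transfer_pow_le N h s).trans
      ((transfer_pow_mono N (fun t => hhV t) s).trans (transfer_pow_le_of_drift hV s N))
  have hlim : Filter.Tendsto (fun N : ℕ => (transfer l₁ l₂ step ^ N) h s / (N : ℝ))
      Filter.atTop (𝓝 0) := by
    have h1 : Filter.Tendsto (fun N : ℕ => V s * ((N : ℝ)⁻¹ * (N : ℝ)⁻¹) + c * (N : ℝ)⁻¹)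
        Filter.atTop (𝓝 0) := by
      have := tendsto_inv_atTop_nhds_zero_nat (𝕜 := ℝ)
      simpa using ((this.mul this).const_mul (V s)).add (this.const_mul c)
    have h2 := (Real.continuous_sqrt.tendsto 0).comp h1
    rw [Real.sqrt_zero] at h2
    refine squeeze_zero_norm' ?_ h2
    filter_upwards [Filter.eventually_gt_atTop 0] with N hN
    have hN' : (0 : ℝ) < N := Nat.cast_pos.2 hN
    rw [Real.norm_eq_abs, Function.comp_apply]
    apply Real.abs_le_sqrt
    rw [div_pow, div_le_iff₀ (by positivity)]
    refine (hsq N).trans (le_of_eq ?_)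
    field_simp
  have h1 : Filter.Tendsto (fun N : ℕ => v + h s * (N : ℝ)⁻¹ -
      (transfer l₁ l₂ step ^ N) h s / (N : ℝ)) Filter.atTop (𝓝 v) := by
    simpa using ((tendsto_const_nhds (x := v)).add
      ((tendsto_inv_atTop_nhds_zero_nat (𝕜 := ℝ)).const_mul (h s))).sub hlim
  refine h1.congr' ?_
  filter_upwards [Filter.eventually_gt_atTop 0] with N hN
  have hN' : (N : ℝ) ≠ 0 := Nat.cast_ne_zero.2 hN.ne'
  rw [sum_transfer_pow_eq hP]
  field_simp

theorem transfer_pow_toRealFun_nonneg (f : S → ℕ+) (s : S) (n : ℕ) :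
    0 ≤ (transfer l₁ l₂ step ^ n) (toRealFun f) s := by
  simpa using transfer_pow_mono (l₁ := l₁) (l₂ := l₂) (step := step) n (toRealFun_nonneg f) s

theorem hasLongRunAverage_of_poisson {f : S → ℕ+} {h V : S → ℝ} {v c : ℝ}
    (hP : ∀ s, h s + v = toRealFun f s + transfer l₁ l₂ step h s)
    (hhV : ∀ s, h s ^ 2 ≤ V s)
    (hV : ∀ s, transfer l₁ l₂ step V s ≤ V s + c) :
    HasLongRunAverage (kernel l₁ l₂ step) f (ENNReal.ofReal v) := by
  intro s
  have h3 := (ENNReal.continuous_ofReal.tendsto v).comp (tendsto_average_of_poisson hP hhV hV s)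
  refine h3.congr' ?_
  filter_upwards [Filter.eventually_gt_atTop 0] with N hN
  have hN' : (0 : ℝ) < N := Nat.cast_pos.2 hN
  rw [Function.comp_apply, ENNReal.ofReal_div_of_pos hN', ENNReal.ofReal_natCast,
    ENNReal.ofReal_sum_of_nonneg fun n _ =>
      transfer_pow_toRealFun_nonneg f s n]
  congr 1
  refine Finset.sum_congr rfl fun n _ => ?_
  rw [mean_eq_expect]
  exact (expect_lawAt (toRealFun_nonneg f) s n).symm

/-- A function that grows by at most `1` per slot and is reset to `1` by a slot with an arrival and
an opportunity: the common features of the ages of actuation of the three systems. -/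
structure IsAge (step : S → Slot → S) (f : S → ℕ+) : Prop where
  reset : ∀ s, f (step s ⟨true, true⟩) = 1
  growth : ∀ s e, f (step s e) ≤ f s + 1

/-- A nondecreasing function of the age has, one slot later, an expectation at most that for an age
which is reset with probability exactly `l₁ l₂`. -/
theorem IsAge.transfer_le {f : S → ℕ+} (hf : IsAge step f) {φ : ℝ → ℝ}
    (hφ : MonotoneOn φ (Set.Ici 0)) (s : S) :
    transfer l₁ l₂ step (fun t => φ (toRealFun f t)) s ≤
      (l₁ : ℝ) * l₂ * φ 1 + (1 - (l₁ : ℝ) * l₂) * φ (toRealFun f s + 1) := by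
  have a1 : 0 ≤ (l₁ : ℝ) := l₁.2.1
  have a2 : 0 ≤ (l₂ : ℝ) := l₂.2.1
  have b1 : 0 ≤ 1 - (l₁ : ℝ) := sub_nonneg.2 l₁.2.2
  have b2 : 0 ≤ 1 - (l₂ : ℝ) := sub_nonneg.2 l₂.2.2
  have hg : ∀ e, φ (toRealFun f (step s e)) ≤ φ (toRealFun f s + 1) := fun e => by
    have h1 := hf.growth s e
    rw [← PNat.coe_le_coe] at h1
    have h2 : toRealFun f (step s e) ≤ toRealFun f s + 1 := by
      simp only [toRealFun]
      exact_mod_cast h1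
    exact hφ (toRealFun_nonneg f _) (add_nonneg (toRealFun_nonneg f s) zero_le_one) h2
  have hr : toRealFun f (step s ⟨true, true⟩) = 1 := by simp [toRealFun, hf.reset]
  rw [transfer_apply, hr]
  have e1 := mul_le_mul_of_nonneg_left (hg ⟨true, false⟩) (mul_nonneg a1 b2)
  have e2 := mul_le_mul_of_nonneg_left (hg ⟨false, true⟩) (mul_nonneg b1 a2)
  have e3 := mul_le_mul_of_nonneg_left (hg ⟨false, false⟩) (mul_nonneg b1 b2)
  linarith

/-- An age has a finite expectation under every stationary law. The drift inequality
`E f' ≤ 1 + (1 - l₁ l₂) f` bounds the expectation of the truncations of `f`, which are known to be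
finite, by `1 / (l₁ l₂)`. -/
theorem IsAge.expect_ne_top {f : S → ℕ+} (hf : IsAge step f) (h₁ : 0 < (l₁ : ℝ))
    (h₂ : 0 < (l₂ : ℝ)) {π : PMF S} (hπ : IsStationary (kernel l₁ l₂ step) π) :
    (expect π fun s => ENNReal.ofReal (toRealFun f s)) ≠ ∞ := by
  have hp : 0 < (l₁ : ℝ) * l₂ := mul_pos h₁ h₂
  have hp1 : (l₁ : ℝ) * l₂ ≤ 1 := mul_le_one₀ l₁.2.2 h₂.le l₂.2.2
  have key : ∀ M : ℕ, (expect π fun s => ENNReal.ofReal (min (toRealFun f s) M)) ≤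
      ENNReal.ofReal (1 / ((l₁ : ℝ) * l₂)) := by
    intro M
    have h0 : (0 : S → ℝ) ≤ fun s => min (toRealFun f s) M := fun s =>
      le_min (toRealFun_nonneg f s) (Nat.cast_nonneg M)
    set t := expect π fun s => ENNReal.ofReal (min (toRealFun f s) M) with ht
    have htop : t ≠ ∞ := by
      have : t ≤ expect π fun _ => ENNReal.ofReal M :=
        expect_mono π fun s => ENNReal.ofReal_le_ofReal (min_le_right _ _)
      rw [expect_const] at this
      exact ne_top_of_le_ne_top ENNReal.ofReal_ne_top this
    have hle : t ≤ 1 + ENNReal.ofReal (1 - (l₁ : ℝ) * l₂) * t := by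
      calc t = expect π fun s => ENNReal.ofReal
              (transfer l₁ l₂ step (fun s => min (toRealFun f s) M) s) :=
            (hπ.expect_transfer h0).symm
        _ ≤ expect π fun s => 1 + ENNReal.ofReal (1 - (l₁ : ℝ) * l₂) *
              ENNReal.ofReal (min (toRealFun f s) M) := by
            refine expect_mono π fun s => ?_
            rw [← ENNReal.ofReal_mul (by linarith), ← ENNReal.ofReal_one,
              ← ENNReal.ofReal_add zero_le_one (mul_nonneg (by linarith) (h0 s))]
            apply ENNReal.ofReal_le_ofReal
            refine (hf.transfer_le (φ := fun a => min a (M : ℝ))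
              (fun a _ b _ hab => min_le_min_right _ hab) s).trans ?_
            have e1 : min (1 : ℝ) M ≤ 1 := min_le_left _ _
            have e2 : min (toRealFun f s + 1) (M : ℝ) ≤ min (toRealFun f s) M + 1 := by
              rw [← min_add_add_right]
              exact min_le_min_left _ (by linarith)
            have e3 := mul_le_mul_of_nonneg_left e1 hp.le
            have e4 := mul_le_mul_of_nonneg_left e2 (sub_nonneg.2 hp1)
            linarith
        _ = 1 + ENNReal.ofReal (1 - (l₁ : ℝ) * l₂) * t := by
            rw [expect_add, expect_const, expect_const_mul]
    have hr := ENNReal.toReal_mono (by finiteness) hle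
    rw [ENNReal.toReal_add (by simp) (by finiteness), ENNReal.toReal_mul,
      ENNReal.toReal_ofReal (by linarith), ENNReal.toReal_one] at hr
    rw [← ENNReal.ofReal_toReal htop]
    apply ENNReal.ofReal_le_ofReal
    rw [le_div_iff₀ hp]
    linarith
  refine ne_top_of_le_ne_top (b := ENNReal.ofReal (1 / ((l₁ : ℝ) * l₂))) ENNReal.ofReal_ne_top ?_
  rw [expect, ENNReal.tsum_eq_iSup_sum]
  refine iSup_le fun F => ?_
  refine le_trans ?_ (key (∑ s ∈ F, (f s : ℕ)))
  refine le_trans (Finset.sum_le_sum fun s hs => ?_) (ENNReal.sum_le_tsum F)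
  beta_reduce
  rw [min_eq_left]
  rw [toRealFun, Nat.cast_le]
  exact Finset.single_le_sum (f := fun s => (f s : ℕ)) (fun _ _ => Nat.zero_le _) hs

/-- The stationary expectation of an age is the constant of its Poisson equation, if there is a
solution which is bounded below and at most linear in the age, hence integrable. -/
theorem IsAge.mean_eq_of_poisson {f : S → ℕ+} (hf : IsAge step f) (h₁ : 0 < (l₁ : ℝ))
    (h₂ : 0 < (l₂ : ℝ)) {h : S → ℝ} {v C D : ℝ} (hv : 0 ≤ v)
    (hP : ∀ s, h s + v = toRealFun f s + transfer l₁ l₂ step h s)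
    (hC : ∀ s, h s ≤ C * toRealFun f s) (hD : ∀ s, 0 ≤ h s + D)
    {π : PMF S} (hπ : IsStationary (kernel l₁ l₂ step) π) :
    mean π f = ENNReal.ofReal v := by
  have h0 : (0 : S → ℝ) ≤ h + D • (1 : S → ℝ) := fun s => by simpa using hD s
  have hfin := hf.expect_ne_top h₁ h₂ hπ
  have htr := hπ.expect_transfer h0
  set E := expect π fun s => ENNReal.ofReal ((h + D • (1 : S → ℝ)) s) with hE
  have hEtop : E ≠ ∞ := by
    have : E ≤ expect π fun s => ENNReal.ofReal (|C| + |D|) * ENNReal.ofReal (toRealFun f s) := by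
      refine expect_mono π fun s => ?_
      rw [← ENNReal.ofReal_mul (by positivity)]
      apply ENNReal.ofReal_le_ofReal
      have e0 := one_le_toRealFun f s
      have e1 := hC s
      have e2 : C * toRealFun f s ≤ |C| * toRealFun f s :=
        mul_le_mul_of_nonneg_right (le_abs_self C) (by linarith)
      have e3 : |D| * 1 ≤ |D| * toRealFun f s := mul_le_mul_of_nonneg_left e0 (abs_nonneg D)
      have e4 := le_abs_self D
      simp only [Pi.add_apply, Pi.smul_apply, Pi.one_apply, smul_eq_mul, mul_one]
      linarith
    rw [expect_const_mul] at this
    exact ne_top_of_le_ne_top (ENNReal.mul_ne_top ENNReal.ofReal_ne_top hfin) this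
  have heq : E + ENNReal.ofReal v = mean π f + E := by
    rw [mean_eq_expect]
    conv_rhs => rw [← htr]
    rw [← expect_add, hE, ← expect_const π (ENNReal.ofReal v), ← expect_add]
    refine congrArg (expect π) (funext fun s => ?_)
    rw [← ENNReal.ofReal_add (h0 s) hv,
      ← ENNReal.ofReal_add (Nat.cast_nonneg _) (transfer_nonneg h0 s), map_add, map_smul,
      transfer_one]
    congr 1
    have := hP s
    simp only [toRealFun] at this
    simp only [Pi.add_apply, Pi.smul_apply, Pi.one_apply, smul_eq_mul, mul_one]
    linarith
  rw [add_comm] at heq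
  exact ((ENNReal.add_left_inj hEtop).1 heq).symm

/-- The square of an age has a bounded drift. -/
theorem IsAge.transfer_sq_le {f : S → ℕ+} (hf : IsAge step f) (h₁ : 0 < (l₁ : ℝ))
    (h₂ : 0 < (l₂ : ℝ)) (s : S) :
    transfer l₁ l₂ step (fun t => toRealFun f t ^ 2) s ≤
      toRealFun f s ^ 2 + (1 + 1 / ((l₁ : ℝ) * l₂)) := by
  have hp : 0 < (l₁ : ℝ) * l₂ := mul_pos h₁ h₂
  refine (hf.transfer_le (φ := fun a => a ^ 2)
    (fun a ha b _ hab => pow_le_pow_left₀ ha hab 2) s).trans ?_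
  have h0 := toRealFun_nonneg f s
  simp only [Pi.zero_apply] at h0
  have h1 : 0 ≤ ((l₁ : ℝ) * l₂ * toRealFun f s - 1) ^ 2 / ((l₁ : ℝ) * l₂) := by positivity
  have h2 : ((l₁ : ℝ) * l₂ * toRealFun f s - 1) ^ 2 / ((l₁ : ℝ) * l₂) =
      (l₁ : ℝ) * l₂ * toRealFun f s ^ 2 - 2 * toRealFun f s + 1 / ((l₁ : ℝ) * l₂) := by
    field_simp
    ring
  nlinarith [mul_nonneg hp.le h0]

/-- If the state next to an age `f` has finitely many values, then a solution of the Poisson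
equation that is affine in `f` gives the long-run and the stationary averages. -/
theorem IsAge.averages_of_affine_poisson {σ : Type} [Fintype σ] {f : S → ℕ+} (hf : IsAge step f)
    (h₁ : 0 < (l₁ : ℝ)) (h₂ : 0 < (l₂ : ℝ)) (j : S → σ) (g k : σ → ℝ) (hg : ∀ i, 0 ≤ g i) {v : ℝ}
    (hP : ∀ s, g (j s) * toRealFun f s + k (j s) + v =
      toRealFun f s + transfer l₁ l₂ step (fun t => g (j t) * toRealFun f t + k (j t)) s)
    (hex : ∃! π, IsStationary (kernel l₁ l₂ step) π) :
    HasStationaryAverage (kernel l₁ l₂ step) f (ENNReal.ofReal v) ∧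
      HasLongRunAverage (kernel l₁ l₂ step) f (ENNReal.ofReal v) := by
  set G := ∑ i, g i
  set M := ∑ i, |k i|
  have hG : ∀ i, g i ≤ G := fun i =>
    Finset.single_le_sum (f := g) (fun i _ => hg i) (Finset.mem_univ i)
  have hM : ∀ i, |k i| ≤ M := fun i =>
    Finset.single_le_sum (f := fun i => |k i|) (fun i _ => abs_nonneg _) (Finset.mem_univ i)
  have hbound : ∀ s, |g (j s) * toRealFun f s + k (j s)| ≤ (G + M) * toRealFun f s := fun s => by
    have h0 := one_le_toRealFun f s
    have h1 := hG (j s)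
    have h2 := hM (j s)
    have h3 := hg (j s)
    have h4 := abs_nonneg (k (j s))
    refine (abs_add_le _ _).trans ?_
    rw [abs_of_nonneg (mul_nonneg h3 (by linarith))]
    nlinarith
  have hsq : ∀ s, (g (j s) * toRealFun f s + k (j s)) ^ 2 ≤
      ((G + M) ^ 2 • fun t => toRealFun f t ^ 2) s := fun s => by
    simp only [Pi.smul_apply, smul_eq_mul]
    rw [← mul_pow, ← sq_abs (g (j s) * toRealFun f s + k (j s))]
    exact pow_le_pow_left₀ (abs_nonneg _) (hbound s) 2
  have hdrift : ∀ s, transfer l₁ l₂ step ((G + M) ^ 2 • fun t => toRealFun f t ^ 2) s ≤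
      ((G + M) ^ 2 • fun t => toRealFun f t ^ 2) s +
        (G + M) ^ 2 * (1 + 1 / ((l₁ : ℝ) * l₂)) := fun s => by
    rw [map_smul]
    simp only [Pi.smul_apply, smul_eq_mul]
    rw [← mul_add]
    exact mul_le_mul_of_nonneg_left (hf.transfer_sq_le h₁ h₂ s) (sq_nonneg _)
  refine ⟨⟨hex, fun π hπ => ?_⟩, hasLongRunAverage_of_poisson hP hsq hdrift⟩
  obtain ⟨s, -⟩ := π.support_nonempty
  have hv : 0 ≤ v := ge_of_tendsto' (tendsto_average_of_poisson hP hsq hdrift s) fun N =>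
    div_nonneg (Finset.sum_nonneg fun n _ => transfer_pow_toRealFun_nonneg f s n)
      (Nat.cast_nonneg N)
  refine hf.mean_eq_of_poisson h₁ h₂ (D := M) hv hP (fun s => (le_abs_self _).trans (hbound s))
    (fun s => ?_) hπ
  have h2 := hM (j s)
  have h3 := neg_abs_le (k (j s))
  have h4 := mul_nonneg (hg (j s)) (zero_le_one.trans (one_le_toRealFun f s))
  linarith

/-! ### Uniqueness of the stationary distribution -/

theorem eq_of_le_of_tsum_le {f g : S → ℝ≥0∞} (hfg : ∀ s, f s ≤ g s) (hf : ∑' s, f s ≠ ∞)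
    (hsum : ∑' s, g s ≤ ∑' s, f s) : f = g := by
  funext s
  by_contra hs
  exact (ENNReal.tsum_lt_tsum hf hfg (lt_of_le_of_ne (hfg s) hs)).not_ge hsum

theorem pmf_eq_of_le {μ ν : PMF S} (h : ∀ s, μ s ≤ ν s) : μ = ν := by
  apply DFunLike.coe_injective
  exact eq_of_le_of_tsum_le h (by simp [PMF.tsum_coe]) (by simp [PMF.tsum_coe])

theorem tsum_tsum_mul_kernel (m : S → ℝ≥0∞) (K : S → PMF S) :
    ∑' t, ∑' s, m s * K s t = ∑' s, m s := by
  rw [ENNReal.tsum_comm]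
  simp only [ENNReal.tsum_mul_left, PMF.tsum_coe, mul_one]

/-- The excess `π - π'` of a stationary law over another one is an invariant measure. -/
theorem IsStationary.sub_invariant {K : S → PMF S} {π π' : PMF S} (hπ : IsStationary K π)
    (hπ' : IsStationary K π') (t : S) : ∑' s, (π s - π' s) * K s t = π t - π' t := by
  have hst : ∀ {ρ : PMF S}, IsStationary K ρ → ∀ t, ∑' s, ρ s * K s t = ρ t := fun hρ t => by
    rw [← PMF.bind_apply, show _ = _ from hρ]
  -- The minimum of the two laws is superinvariant, and has a finite mass: it is invariant.
  set m : S → ℝ≥0∞ := fun s => min (π s) (π' s) with hm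
  have hmass : ∑' s, m s ≠ ∞ := by
    refine ne_top_of_le_ne_top (b := 1) (by simp) ?_
    rw [← PMF.tsum_coe π]
    exact ENNReal.tsum_le_tsum fun s => min_le_left _ _
  have hmK : (fun t => ∑' s, m s * K s t) = m := by
    refine eq_of_le_of_tsum_le (fun t => le_min ?_ ?_) ?_ ?_
    · rw [← hst hπ t]
      exact ENNReal.tsum_le_tsum fun s => mul_le_mul_left (min_le_left _ _) _
    · rw [← hst hπ' t]
      exact ENNReal.tsum_le_tsum fun s => mul_le_mul_left (min_le_right _ _) _
    · rwa [tsum_tsum_mul_kernel]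
    · rw [tsum_tsum_mul_kernel]
  have hsub : ∀ s, π s - π' s + m s = π s := fun s => by
    rw [hm]
    rcases le_total (π s) (π' s) with h | h
    · simp [h, tsub_eq_zero_of_le h]
    · simp only [min_eq_right h]
      exact tsub_add_cancel_of_le h
  have hmt : m t ≠ ∞ := ne_top_of_le_ne_top (π.apply_ne_top t) (min_le_left _ _)
  refine (ENNReal.add_left_inj hmt).1 ?_
  rw [hsub]
  conv_lhs => rw [← congrFun hmK t]
  rw [← ENNReal.tsum_add]
  simp only [← add_mul, hsub]
  exact hst hπ t

theorem tsum_mul_lawAt {K : S → PMF S} {d : S → ℝ≥0∞} (hd : ∀ t, ∑' s, d s * K s t = d t)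
    (n : ℕ) (t : S) : ∑' s, d s * lawAt K s n t = d t := by
  induction n generalizing t with
  | zero =>
    rw [tsum_eq_single t]
    · simp [lawAt]
    · intro s hs
      simp [lawAt, PMF.pure_apply, hs.symm]
  | succ n ih =>
    simp only [lawAt, PMF.bind_apply, ← ENNReal.tsum_mul_left]
    rw [ENNReal.tsum_comm]
    simp only [← mul_assoc, ENNReal.tsum_mul_right, ih]
    exact hd t

/-- There is at most one stationary distribution if some state can be reached from all states: the
excesses `π - π'` and `π' - π` are invariant, so both would charge that state unless one of them
vanishes. -/
theorem IsStationary.unique_of_accessible {K : S → PMF S} {s₀ : S}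
    (hacc : ∀ s, ∃ n, lawAt K s n s₀ ≠ 0) {π π' : PMF S} (hπ : IsStationary K π)
    (hπ' : IsStationary K π') : π = π' := by
  have key : ∀ {ρ ρ' : PMF S}, IsStationary K ρ → IsStationary K ρ' → ρ s₀ ≤ ρ' s₀ → ρ = ρ' := by
    intro ρ ρ' hρ hρ' hle
    refine pmf_eq_of_le fun s => ?_
    obtain ⟨n, hn⟩ := hacc s
    have h1 := tsum_mul_lawAt (hρ.sub_invariant hρ') n s₀
    rw [tsub_eq_zero_of_le hle, ENNReal.tsum_eq_zero] at h1
    exact tsub_eq_zero_iff_le.1 ((mul_eq_zero.1 (h1 s)).resolve_right hn)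
  rcases le_total (π s₀) (π' s₀) with h | h
  · exact key hπ hπ' h
  · exact (key hπ' hπ h).symm

/-! ### Existence of the stationary distribution -/

/-- If a state is reached in one step with a probability at least `ε > 0` from everywhere, then a
stationary distribution exists: it is the law `∑ₙ ε δ Rⁿ` of the chain started at that state and
observed at an independent geometric time, where `K = R + ε δ`. -/
theorem exists_isStationary_of_minorization {K : S → PMF S} {s₀ : S} {ε : ℝ≥0∞} (hε : ε ≠ 0)
    (hK : ∀ s, ε ≤ K s s₀) : ∃ π, IsStationary K π := by
  classical
  have hε1 : ε ≤ 1 := (hK s₀).trans (PMF.coe_le_one _ _)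
  have hεtop : ε ≠ ∞ := ne_top_of_le_ne_top (by simp) hε1
  set δ : S → ℝ≥0∞ := fun t => if t = s₀ then ε else 0 with hδ
  have hδsum : ∑' t, δ t = ε := tsum_ite_eq s₀ _
  have hδK : ∀ s t, δ t ≤ K s t := fun s t => by
    simp only [hδ]
    split_ifs with h
    · rw [h]; exact hK s
    · exact zero_le
  set R : S → S → ℝ≥0∞ := fun s t => K s t - δ t with hR
  have hRK : ∀ s t, R s t + δ t = K s t := fun s t => tsub_add_cancel_of_le (hδK s t)
  have hRsum : ∀ s, ∑' t, R s t = 1 - ε := fun s => by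
    refine ENNReal.eq_sub_of_add_eq hεtop ?_
    rw [← hδsum, ← ENNReal.tsum_add]
    simp only [hRK, PMF.tsum_coe]
  let μ : ℕ → S → ℝ≥0∞ := fun n => Nat.rec δ (fun _ ν t => ∑' s, ν s * R s t) n
  have hμs : ∀ n t, μ (n + 1) t = ∑' s, μ n s * R s t := fun _ _ => rfl
  have hμsum : ∀ n, ∑' t, μ n t = ε * (1 - ε) ^ n := by
    intro n
    induction n with
    | zero => rw [pow_zero, mul_one]; exact hδsum
    | succ n ih =>
      simp only [hμs]
      rw [ENNReal.tsum_comm]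
      simp only [ENNReal.tsum_mul_left, hRsum, ENNReal.tsum_mul_right]
      rw [ih, pow_succ, mul_assoc]
  have hmass : ∑' t, ∑' n, μ n t = 1 := by
    rw [ENNReal.tsum_comm]
    simp only [hμsum]
    rw [ENNReal.tsum_mul_left, ENNReal.tsum_geometric,
      ENNReal.sub_sub_cancel ENNReal.one_ne_top hε1, ENNReal.mul_inv_cancel hε hεtop]
  let π : PMF S := ⟨fun t => ∑' n, μ n t, ENNReal.summable.hasSum_iff.2 hmass⟩
  have hπ : ∀ t, π t = ∑' n, μ n t := fun _ => rfl
  refine ⟨π, PMF.ext fun t => ?_⟩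
  simp only [PMF.bind_apply, hπ, ← hRK, mul_add]
  rw [ENNReal.tsum_add, ENNReal.tsum_mul_right, hmass, one_mul,
    tsum_eq_zero_add' (f := fun n => μ n t) ENNReal.summable, add_comm]
  congr 1
  simp only [hμs, ← ENNReal.tsum_mul_right]
  exact ENNReal.tsum_comm

theorem bind_lawAt_comm (K : S → PMF S) (s : S) (n : ℕ) :
    ((K s).bind fun t => lawAt K t n) = (lawAt K s n).bind K := by
  induction n with
  | zero => simp [lawAt]
  | succ n ih => simp only [lawAt, ← PMF.bind_bind, ih]

/-- The stationary law of the `m`-step chain is unique, so it is also stationary for the chain. -/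
theorem existsUnique_isStationary_of_minorization {K : S → PMF S} {s₀ : S} {m : ℕ} {ε : ℝ≥0∞}
    (hε : ε ≠ 0) (hK : ∀ s, ε ≤ lawAt K s m s₀) : ∃! π, IsStationary K π := by
  have hne : ∀ s, lawAt K s m s₀ ≠ 0 := fun s h => hε (le_zero_iff.1 (h ▸ hK s))
  obtain ⟨π, hπ⟩ := exists_isStationary_of_minorization (K := fun s => lawAt K s m) hε hK
  refine ⟨π, ?_, fun π' hπ' => IsStationary.unique_of_accessible (fun s => ⟨m, hne s⟩) hπ' ?_⟩
  all_goals
    refine IsStationary.unique_of_accessible (K := fun s => lawAt K s m) (s₀ := s₀)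
      (fun s => ⟨1, by simpa [lawAt] using hne s⟩) ?_ hπ
    change (π.bind K).bind (fun s => lawAt K s m) = π.bind K
    conv_rhs => rw [← show π.bind (fun s => lawAt K s m) = π from hπ]
    simp only [PMF.bind_bind, bind_lawAt_comm]

/-- The chain follows a word of slots with at least the probability of the word. -/
theorem prod_slotLaw_le_lawAt (s : S) (es : List Slot) :
    (es.map (slotLaw l₁ l₂)).prod ≤ lawAt (kernel l₁ l₂ step) s es.length (es.foldl step s) := by
  induction es using List.reverseRecOn with
  | nil => simp [lawAt]
  | append_singleton es e ih =>
    simp only [List.map_append, List.prod_append, List.map_cons, List.map_nil, List.prod_singleton,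
      List.length_append, List.length_singleton, List.foldl_append, List.foldl_cons, List.foldl_nil,
      lawAt, PMF.bind_apply]
    refine le_trans (mul_le_mul' ih ?_)
      (ENNReal.le_tsum (f := fun t => _ * kernel l₁ l₂ step t (step (es.foldl step s) e))
        (es.foldl step s))
    classical
    rw [kernel, PMF.map_apply]
    exact le_trans (by simp) (ENNReal.le_tsum e)

theorem slotLaw_ne_zero {a o : Bool} (ha : coin l₁ a ≠ 0) (ho : coin l₂ o ≠ 0) :
    slotLaw l₁ l₂ ⟨a, o⟩ ≠ 0 := by
  rw [slotLaw_apply]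
  exact mul_ne_zero ha ho

theorem coin_true_ne_zero {p : unitInterval} (h : 0 < (p : ℝ)) : coin p true ≠ 0 := by
  rw [coin_true]
  exact (ENNReal.ofReal_pos.2 h).ne'

theorem coin_false_ne_zero {p : unitInterval} (h : (p : ℝ) < 1) : coin p false ≠ 0 := by
  rw [coin_false]
  exact (ENNReal.ofReal_pos.2 (sub_pos.2 h)).ne'

theorem lawAt_ne_zero_of_word {es : List Slot} (hes : ∀ e ∈ es, slotLaw l₁ l₂ e ≠ 0) (s : S) :
    lawAt (kernel l₁ l₂ step) s es.length (es.foldl step s) ≠ 0 := by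
  intro h
  have h0 := prod_slotLaw_le_lawAt (l₁ := l₁) (l₂ := l₂) (step := step) s es
  rw [h, le_zero_iff, List.prod_eq_zero_iff, List.mem_map] at h0
  obtain ⟨e, he, h1⟩ := h0
  exact hes e he h1

/-- A word of slots of positive probability that synchronizes the system, in the sense that it leads
to the same state from everywhere, gives a unique stationary distribution. -/
theorem existsUnique_isStationary_of_word {es : List Slot} {s₀ : S}
    (hes : ∀ e ∈ es, slotLaw l₁ l₂ e ≠ 0) (hs₀ : ∀ s, es.foldl step s = s₀) :
    ∃! π, IsStationary (kernel l₁ l₂ step) π := by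
  refine existsUnique_isStationary_of_minorization (s₀ := s₀) (m := es.length)
    (ε := (es.map (slotLaw l₁ l₂)).prod) ?_ fun s => hs₀ s ▸ prod_slotLaw_le_lawAt s es
  rw [Ne, List.prod_eq_zero_iff, List.mem_map]
  rintro ⟨e, he, h⟩
  exact hes e he h

/-! ### Single-packet buffer -/

theorem nextAge_le (A : ℕ+) (b : Bool) : nextAge A b ≤ A + 1 := by
  cases b
  · exact le_rfl
  · exact one_le

theorem isAge_bufferStep : IsAge bufferStep BufferState.age where
  reset s := by simp [bufferStep, nextAge]
  growth s e := nextAge_le _ _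

theorem buffer_averages (h₁ : 0 < (l₁ : ℝ)) (h₂ : 0 < (l₂ : ℝ)) {v : ℝ}
    (hv : v = (((l₂ : ℝ) - 1) * ((l₁ : ℝ) ^ 2 + (l₁ : ℝ) * (l₂ : ℝ)) - (l₂ : ℝ) ^ 2) /
        ((l₁ : ℝ) * (l₂ : ℝ) * ((l₁ : ℝ) * ((l₂ : ℝ) - 1) - (l₂ : ℝ)))) :
    HasStationaryAverage (kernel l₁ l₂ bufferStep) BufferState.age (ENNReal.ofReal v) ∧
      HasLongRunAverage (kernel l₁ l₂ bufferStep) BufferState.age (ENNReal.ofReal v) := by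
  have b1 : 0 ≤ 1 - (l₁ : ℝ) := sub_nonneg.2 l₁.2.2
  have b2 : 0 ≤ 1 - (l₂ : ℝ) := sub_nonneg.2 l₂.2.2
  have hd : (l₁ : ℝ) * ((l₂ : ℝ) - 1) - l₂ ≠ 0 := by nlinarith
  -- The coefficient of the age in `h` is the mean time until the next actuation.
  refine isAge_bufferStep.averages_of_affine_poisson h₁ h₂ BufferState.full
    (fun b => if b then 1 / (l₂ : ℝ) else 1 / (l₁ : ℝ) + (1 - l₂) / l₂)
    (fun b => if b then (1 - (l₁ : ℝ)) ^ 2 * (1 - l₂) / (l₁ * (l₁ * (l₂ - 1) - l₂)) else 0)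
    (fun b => ?_) (fun s => ?_) ?_
  · cases b
    · exact add_nonneg (by positivity) (div_nonneg b2 h₂.le)
    · simp only [if_true]; positivity
  · obtain ⟨a, full⟩ := s
    subst hv
    cases full <;> simp [transfer_apply, bufferStep, nextAge, toRealFun] <;> field_simp <;> ring
  · refine existsUnique_isStationary_of_word (es := [⟨true, true⟩]) (s₀ := ⟨1, false⟩) ?_ ?_
    · intro e he
      rw [List.mem_singleton.1 he]
      exact slotLaw_ne_zero (coin_true_ne_zero h₁) (coin_true_ne_zero h₂)
    · intro s
      simp [bufferStep, nextAge]

/-! ### Single-packet buffer with a unit battery -/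

theorem isAge_batteryStep : IsAge batteryStep BatteryState.age where
  reset s := by simp [batteryStep, nextAge]
  growth s e := nextAge_le _ _

theorem existsUnique_isStationary_battery (h₁ : 0 < (l₁ : ℝ)) (h₂ : 0 < (l₂ : ℝ))
    (h : ¬ ((l₁ : ℝ) = 1 ∧ (l₂ : ℝ) = 1)) :
    ∃! π, IsStationary (kernel l₁ l₂ batteryStep) π := by
  have c1 := coin_true_ne_zero h₁
  have c2 := coin_true_ne_zero h₂
  rcases lt_or_eq_of_le (show (l₂ : ℝ) ≤ 1 from l₂.2.2) with hy | hy
  · -- A full battery is emptied by the second slot of this word.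
    refine existsUnique_isStationary_of_word
      (es := [⟨true, true⟩, ⟨true, false⟩, ⟨true, true⟩]) (s₀ := ⟨1, false, false⟩) ?_ ?_
    · have c3 := coin_false_ne_zero hy
      simp [slotLaw_ne_zero, c1, c2, c3]
    · rintro ⟨a, full, charged⟩
      cases full <;> cases charged <;> simp [batteryStep, nextAge]
  · -- An empty battery is charged by the second slot of this word.
    have hx : (l₁ : ℝ) < 1 := lt_of_le_of_ne l₁.2.2 fun hx => h ⟨hx, hy⟩
    refine existsUnique_isStationary_of_word
      (es := [⟨true, true⟩, ⟨false, true⟩, ⟨true, true⟩]) (s₀ := ⟨1, false, true⟩) ?_ ?_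
    · have c3 := coin_false_ne_zero hx
      simp [slotLaw_ne_zero, c1, c2, c3]
    · rintro ⟨a, full, charged⟩
      cases full <;> cases charged <;> simp [batteryStep, nextAge]

theorem battery_averages (h₁ : 0 < (l₁ : ℝ)) (h₂ : 0 < (l₂ : ℝ))
    (h : ¬ ((l₁ : ℝ) = 1 ∧ (l₂ : ℝ) = 1)) {v : ℝ}
    (hv : v = ((l₁ : ℝ) ^ 4 * ((l₂ : ℝ) - 1) ^ 3
          - 2 * (l₁ : ℝ) ^ 3 * (l₂ : ℝ) * ((l₂ : ℝ) - 1) ^ 2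
          - (l₁ : ℝ) ^ 2 * (l₂ : ℝ) ^ 2 * (2 * (l₂ : ℝ) ^ 2 - 3 * (l₂ : ℝ) + 1)
          + (l₁ : ℝ) * (l₂ : ℝ) ^ 3 * (3 * (l₂ : ℝ) - 2) - (l₂ : ℝ) ^ 4) /
        ((l₁ : ℝ) * (l₂ : ℝ) * ((l₁ : ℝ) * ((l₂ : ℝ) - 1) - (l₂ : ℝ)) *
          ((l₁ : ℝ) ^ 2 * ((l₂ : ℝ) - 1) ^ 2 + (l₁ : ℝ) * (-2 * (l₂ : ℝ) ^ 2 + (l₂ : ℝ))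
            + (l₂ : ℝ) ^ 2))) :
    HasStationaryAverage (kernel l₁ l₂ batteryStep) BatteryState.age (ENNReal.ofReal v) ∧
      HasLongRunAverage (kernel l₁ l₂ batteryStep) BatteryState.age (ENNReal.ofReal v) := by
  have hex := existsUnique_isStationary_battery h₁ h₂ h
  have b1 : 0 ≤ 1 - (l₁ : ℝ) := sub_nonneg.2 l₁.2.2
  have b2 : 0 ≤ 1 - (l₂ : ℝ) := sub_nonneg.2 l₂.2.2
  set x : ℝ := (l₁ : ℝ) with ex
  set y : ℝ := (l₂ : ℝ) with ey
  have hq : 0 < x + y - x * y := by nlinarith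
  -- The mean time until the next actuation, when neither a packet nor energy is stored.
  set w : ℝ := (1 + x * (1 - y) / y + (1 - x) * y / x) / (x + y - x * y) with hw
  have hw0 : 0 ≤ w := by positivity
  let g : Bool × Bool → ℝ := fun i => match i with
    | (false, false) => w
    | (false, true) => 1 / x
    | (true, false) => 1 / y
    | (true, true) => 1
  have hg : ∀ i, 0 ≤ g i := by
    rintro ⟨_ | _, _ | _⟩ <;> simp only [g] <;> positivity
  rcases lt_or_eq_of_le (show y ≤ 1 from l₂.2.2) with hy | hy
  · -- The constant terms of `h` solve a linear system which degenerates at `y = 1`.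
    have hy' : 0 < 1 - y := sub_pos.2 hy
    have hd1 : x * (y - 1) - y ≠ 0 := by nlinarith
    have hd2 : x ^ 2 * (y - 1) ^ 2 + x * (-2 * y ^ 2 + y) + y ^ 2 ≠ 0 := by
      have : 0 < (x * (1 - y)) ^ 2 + x * y * (1 - y) + y ^ 2 * (1 - x) := by positivity
      intro h0
      linarith
    obtain ⟨D, hD⟩ : ∃ D, D = x ^ 2 * (y - 1) ^ 2 + x * (-2 * y ^ 2 + y) + y ^ 2 := ⟨_, rfl⟩
    rw [← hD] at hv hd2
    refine isAge_batteryStep.averages_of_affine_poisson h₁ h₂ (fun s => (s.full, s.charged)) g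
      (fun i => match i with
        | (false, false) => 0
        | (false, true) => w + (x * y + (1 - x)) / (x ^ 2 * (1 - y)) - v / (x * (1 - y))
        | (true, false) => w + (1 - y) / y ^ 2 - v / y
        | (true, true) => -v + y * (1 / x + (w + (x * y + (1 - x)) / (x ^ 2 * (1 - y))
            - v / (x * (1 - y)))) + (1 - y) * w) hg (fun s => ?_) hex
    obtain ⟨a, full, charged⟩ := s
    cases full <;> cases charged <;>
      simp [transfer_apply, batteryStep, nextAge, toRealFun, ← ex, ← ey, g]
    · rw [hv, hw]; field_simp; rw [hD]; ring
    · rw [hw]; field_simp; ring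
    · rw [hw]; field_simp; ring
    · ring
  · -- Energy is always available, so that only the presence of a packet matters.
    have hx : 0 < 1 - x := sub_pos.2 (lt_of_le_of_ne l₁.2.2 fun hx => h ⟨hx, hy⟩)
    have hv' : v = 1 / x := by
      have hd : x * y * (x * (y - 1) - y) *
          (x ^ 2 * (y - 1) ^ 2 + x * (-2 * y ^ 2 + y) + y ^ 2) = -(x * (1 - x)) := by
        rw [hy]; ring
      rw [hv, hd, hy, div_eq_div_iff (neg_ne_zero.2 (mul_pos h₁ hx).ne') h₁.ne']
      ring
    have hw' : w = 1 / x := by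
      rw [hw, hy]
      field_simp
      ring
    refine isAge_batteryStep.averages_of_affine_poisson h₁ h₂ (fun s => (s.full, s.charged)) g
      0 hg (fun s => ?_) hex
    obtain ⟨a, full, charged⟩ := s
    cases full <;> cases charged <;>
      simp [transfer_apply, batteryStep, nextAge, toRealFun, ← ex, ← ey, g, hv', hw']
    all_goals first | done | (rw [hy]; field_simp; ring)

/-! ### Infinite queue: long-run averages -/

theorem isAge_queueStep : IsAge queueStep QueueState.age where
  reset s := by simp [queueStep, nextAge]
  growth s e := nextAge_le _ _

/-- The solution of the Poisson equation of the infinite queue. The coefficient of the age is the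
mean time until the next actuation. -/
noncomputable def queuePoisson (x y : ℝ) (s : QueueState) : ℝ :=
  if s.length = 0 then (1 / x + 1 / y - 1) * toRealFun QueueState.age s + (1 - 1 / x)
  else 1 / y * toRealFun QueueState.age s - s.length / (x * y)

theorem queuePoisson_eq (h₁ : 0 < (l₁ : ℝ)) (h₂ : 0 < (l₂ : ℝ)) (s : QueueState) :
    queuePoisson l₁ l₂ s + 1 / (l₁ : ℝ) =
      toRealFun QueueState.age s + transfer l₁ l₂ queueStep (queuePoisson l₁ l₂) s := by
  obtain ⟨a, _ | _ | q⟩ := s <;>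
    simp [transfer_apply, queueStep, nextAge, toRealFun, queuePoisson] <;> field_simp <;> ring

theorem abs_queuePoisson_le {x y : ℝ} (hx : 0 < x) (hy : 0 < y) (s : QueueState) :
    |queuePoisson x y s| ≤
      (1 + 2 / x + 1 / y + 1 / (x * y)) * (toRealFun QueueState.age s + s.length) := by
  have ha := one_le_toRealFun QueueState.age s
  set a := toRealFun QueueState.age s
  have hq : (0 : ℝ) ≤ s.length := Nat.cast_nonneg _
  have i1 : 0 < 1 / x := by positivity
  have i2 : 0 < 1 / y := by positivity
  have i3 : 0 < 1 / (x * y) := by positivity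
  have e2 : 2 / x = 2 * (1 / x) := by ring
  rw [queuePoisson, e2]
  set u := 1 / x
  set w := 1 / y
  set z := 1 / (x * y) with hz
  have m1 := mul_nonneg i1.le hq
  have m2 := mul_nonneg i2.le hq
  have m3 := mul_nonneg i3.le hq
  have m4 := mul_nonneg i3.le (zero_le_one.trans ha)
  have m5 := mul_le_mul_of_nonneg_left ha i1.le
  have m6 := mul_le_mul_of_nonneg_left ha i2.le
  split_ifs with h
  · rw [abs_le]
    constructor <;> nlinarith
  · rw [show (s.length : ℝ) / (x * y) = z * s.length by rw [hz]; ring, abs_le]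
    constructor <;> nlinarith

/-- The square of the length of a stable queue has a bounded drift. -/
theorem transfer_length_sq_le (hlt : (l₁ : ℝ) < l₂) (s : QueueState) :
    transfer l₁ l₂ queueStep (fun t => (t.length : ℝ) ^ 2) s ≤ (s.length : ℝ) ^ 2 + 2 := by
  have a1 : 0 ≤ (l₁ : ℝ) := l₁.2.1
  have a2 : 0 ≤ (l₂ : ℝ) := l₂.2.1
  have b1 : (l₁ : ℝ) ≤ 1 := l₁.2.2
  have b2 : (l₂ : ℝ) ≤ 1 := l₂.2.2
  have p := mul_le_mul b1 (sub_le_self (1 : ℝ) a2) (sub_nonneg.2 b2) zero_le_one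
  obtain ⟨a, _ | q⟩ := s
  · simp [transfer_apply, queueStep]
    nlinarith
  · simp [transfer_apply, queueStep]
    have hq : (0 : ℝ) ≤ q := Nat.cast_nonneg _
    have := mul_nonneg (sub_nonneg.2 hlt.le) (by linarith : (0 : ℝ) ≤ 2 * q + 1)
    nlinarith

theorem transfer_comp {φ : S → T} {step' : T → Slot → T}
    (hφ : ∀ s e, φ (step s e) = step' (φ s) e) (g : T → ℝ) (s : S) :
    transfer l₁ l₂ step (fun t => g (φ t)) s = transfer l₁ l₂ step' g (φ s) := by
  simp only [transfer_apply, hφ]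

/-- The age of actuation of any system whose age and number of packets follow the infinite queue. -/
theorem hasLongRunAverage_of_queue (h₁ : 0 < (l₁ : ℝ)) (h₂ : 0 < (l₂ : ℝ))
    (hlt : (l₁ : ℝ) < l₂) {φ : S → QueueState} (hφ : ∀ s e, φ (step s e) = queueStep (φ s) e) :
    HasLongRunAverage (kernel l₁ l₂ step) (fun s => (φ s).age) (ENNReal.ofReal (1 / (l₁ : ℝ))) := by
  set C : ℝ := 1 + 2 / l₁ + 1 / l₂ + 1 / (l₁ * l₂)
  let V : QueueState → ℝ := (2 * C ^ 2) •
    ((fun t => toRealFun QueueState.age t ^ 2) + fun t => (t.length : ℝ) ^ 2)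
  have hV : ∀ s, V s = 2 * C ^ 2 * (toRealFun QueueState.age s ^ 2 + (s.length : ℝ) ^ 2) :=
    fun _ => rfl
  refine hasLongRunAverage_of_poisson (h := fun s => queuePoisson l₁ l₂ (φ s))
    (V := fun s => V (φ s)) (c := 2 * C ^ 2 * (1 + 1 / ((l₁ : ℝ) * l₂) + 2))
    (fun s => ?_) (fun s => ?_) (fun s => ?_)
  · rw [transfer_comp hφ]
    exact queuePoisson_eq h₁ h₂ (φ s)
  · rw [hV, ← sq_abs]
    refine (pow_le_pow_left₀ (abs_nonneg _) (abs_queuePoisson_le h₁ h₂ (φ s)) 2).trans ?_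
    rw [mul_pow, mul_comm 2, mul_assoc]
    refine mul_le_mul_of_nonneg_left ?_ (sq_nonneg _)
    nlinarith [sq_nonneg (toRealFun QueueState.age (φ s) - (φ s).length)]
  · rw [transfer_comp hφ, map_smul, map_add, hV, Pi.smul_apply, smul_eq_mul, Pi.add_apply,
      ← mul_add]
    refine mul_le_mul_of_nonneg_left ?_ (by positivity)
    linarith [isAge_queueStep.transfer_sq_le h₁ h₂ (φ s), transfer_length_sq_le hlt (φ s)]

/-! ### Infinite queue: the packets behind the chain -/

theorem count_packetStep (p : Policy) (s : PacketState) (e : Slot) :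
    (packetStep p s e).count = queueStep s.count e := by
  obtain ⟨a, q⟩ := s
  obtain ⟨_ | _, _ | _⟩ := e <;> cases p <;> cases q <;>
    simp [packetStep, queueStep, PacketState.count, Policy.serve]

theorem map_kernel {φ : S → T} {step' : T → Slot → T}
    (hφ : ∀ s e, φ (step s e) = step' (φ s) e) (s : S) :
    (kernel l₁ l₂ step s).map φ = kernel l₁ l₂ step' (φ s) := by
  rw [kernel, kernel, PMF.map_comp]
  congr 1
  exact funext fun e => hφ s e

/-! ### Infinite queue: the stationary distribution -/

/-- The geometric law on `ℕ` with ratio `r`. -/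
noncomputable def geometric (r : ℝ) (h0 : 0 ≤ r) (h1 : r < 1) : PMF ℕ :=
  ⟨fun n => ENNReal.ofReal ((1 - r) * r ^ n), by
    have h2 : 1 - r ≠ 0 := (sub_pos.2 h1).ne'
    have h3 := (hasSum_geometric_of_lt_one h0 h1).mul_left (1 - r)
    rw [mul_inv_cancel₀ h2] at h3
    rw [ENNReal.summable.hasSum_iff, ← ENNReal.ofReal_tsum_of_nonneg
      (fun n => mul_nonneg (sub_pos.2 h1).le (pow_nonneg h0 n)) h3.summable, h3.tsum_eq,
      ENNReal.ofReal_one]⟩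

theorem geometric_apply {r : ℝ} (h0 : 0 ≤ r) (h1 : r < 1) (n : ℕ) :
    geometric r h0 h1 n = ENNReal.ofReal ((1 - r) * r ^ n) := rfl

theorem expect_geometric {r : ℝ} (h0 : 0 ≤ r) (h1 : r < 1) :
    (expect (geometric r h0 h1) fun n => ENNReal.ofReal ((n : ℝ) + 1)) =
      ENNReal.ofReal (1 / (1 - r)) := by
  have h2 : 0 < 1 - r := sub_pos.2 h1
  have hs : HasSum (fun n : ℕ => (1 - r) * r ^ n * ((n : ℝ) + 1)) (1 / (1 - r)) := by
    have e1 := (hasSum_coe_mul_geometric_of_norm_lt_one (𝕜 := ℝ) (r := r)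
      (by rwa [Real.norm_eq_abs, abs_of_nonneg h0])).add (hasSum_geometric_of_lt_one h0 h1)
    have e2 : 1 / (1 - r) = (1 - r) * (r / (1 - r) ^ 2 + (1 - r)⁻¹) := by
      field_simp
      ring
    rw [e2]
    exact (e1.mul_left (1 - r)).congr_fun fun n => by ring
  simp only [expect, geometric_apply]
  rw [← hs.tsum_eq, ENNReal.ofReal_tsum_of_nonneg (fun n => by positivity) hs.summable]
  exact tsum_congr fun n => (ENNReal.ofReal_mul (by positivity)).symm

/-- The law of an age and a queue length that are independent, with geometric laws of ratios `r`
and `ρ`; ages start at `1`. -/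
noncomputable def productLaw {r ρ : ℝ} (h0 : 0 ≤ r) (h1 : r < 1) (k0 : 0 ≤ ρ) (k1 : ρ < 1) :
    PMF QueueState :=
  (geometric r h0 h1).bind fun n => (geometric ρ k0 k1).map fun q => ⟨n.succPNat, q⟩

theorem productLaw_apply {r ρ : ℝ} (h0 : 0 ≤ r) (h1 : r < 1) (k0 : 0 ≤ ρ) (k1 : ρ < 1) (n q : ℕ) :
    productLaw h0 h1 k0 k1 ⟨n.succPNat, q⟩ = geometric r h0 h1 n * geometric ρ k0 k1 q := by
  classical
  rw [productLaw, PMF.bind_apply, tsum_eq_single n]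
  · rw [PMF.map_apply, tsum_eq_single q]
    · simp
    · intro q' hq'
      simp [hq'.symm]
  · intro n' hn'
    have : ∀ q', (⟨n.succPNat, q⟩ : QueueState) ≠ ⟨n'.succPNat, q'⟩ := fun q' h =>
      hn' (Nat.succPNat_injective (congrArg QueueState.age h)).symm
    simp [PMF.map_apply, this]

theorem tsum_productLaw {r ρ : ℝ} (h0 : 0 ≤ r) (h1 : r < 1) (k0 : 0 ≤ ρ) (k1 : ρ < 1) (q : ℕ) :
    ∑' n : ℕ, productLaw h0 h1 k0 k1 ⟨n.succPNat, q⟩ = geometric ρ k0 k1 q := by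
  simp only [productLaw_apply, ENNReal.tsum_mul_right, PMF.tsum_coe, one_mul]

theorem mean_productLaw {r ρ : ℝ} (h0 : 0 ≤ r) (h1 : r < 1) (k0 : 0 ≤ ρ) (k1 : ρ < 1) :
    mean (productLaw h0 h1 k0 k1) QueueState.age = ENNReal.ofReal (1 / (1 - r)) := by
  rw [mean_eq_expect, productLaw, expect_bind, ← expect_geometric h0 h1]
  simp only [expect_map, expect_const, Nat.succPNat_coe, Nat.cast_succ]

theorem bind_kernel_apply (π : PMF S) (t : S) :
    π.bind (kernel l₁ l₂ step) t =
      slotLaw l₁ l₂ ⟨true, true⟩ * π.map (fun s => step s ⟨true, true⟩) t +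
      slotLaw l₁ l₂ ⟨true, false⟩ * π.map (fun s => step s ⟨true, false⟩) t +
      slotLaw l₁ l₂ ⟨false, true⟩ * π.map (fun s => step s ⟨false, true⟩) t +
      slotLaw l₁ l₂ ⟨false, false⟩ * π.map (fun s => step s ⟨false, false⟩) t := by
  have h : π.bind (kernel l₁ l₂ step) = (slotLaw l₁ l₂).bind fun e => π.map fun s => step s e := by
    have e1 : kernel l₁ l₂ step = fun s => (slotLaw l₁ l₂).bind fun e => PMF.pure (step s e) := by
      funext s
      rw [kernel, ← PMF.bind_pure_comp]
      rfl
    rw [e1, PMF.bind_comm]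
    congr 1
  simp only [slotLaw_apply]
  rw [h, slotLaw, PMF.bind_bind]
  simp only [PMF.bind_map, PMF.bind_apply, tsum_bool, Function.comp_apply]
  ring

theorem apply_le_map_apply (π : PMF S) {φ : S → T} {s : S} {t : T} (h : φ s = t) :
    π s ≤ π.map φ t := by
  classical
  rw [PMF.map_apply]
  exact le_trans (by simp [h]) (ENNReal.le_tsum s)

theorem tsum_le_map_apply (π : PMF S) {φ : S → T} {t : T} {i : ℕ → S}
    (hi : Function.Injective i) (h : ∀ n, φ (i n) = t) : ∑' n, π (i n) ≤ π.map φ t := by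
  classical
  rw [PMF.map_apply]
  refine le_trans (le_of_eq (tsum_congr fun n => ?_))
    (ENNReal.tsum_comp_le_tsum_of_injective hi fun s => if t = φ s then π s else 0)
  simp [h]

theorem injective_queueState (q : ℕ) :
    Function.Injective fun n : ℕ => (⟨n.succPNat, q⟩ : QueueState) := fun _ _ h =>
  Nat.succPNat_injective (congrArg QueueState.age h)

/-- The stationary law of the infinite queue. In equilibrium the actuations up to the end of a slot
are independent of the queue length at that time and form a Bernoulli process of rate `l₁`, as for
the departures in Burke's theorem; thus the age and the length are independent and geometric. The
hypothesis on `ρ` is the detailed balance equation of the queue length. -/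
theorem isStationary_productLaw (h₁ : 0 < (l₁ : ℝ)) (h0 : 0 ≤ 1 - (l₁ : ℝ)) (h1 : 1 - (l₁ : ℝ) < 1)
    {ρ : ℝ} (k0 : 0 ≤ ρ) (k1 : ρ < 1)
    (hρ : (l₁ : ℝ) * (1 - l₂) = l₂ * (1 - l₁) * ρ) :
    IsStationary (kernel l₁ l₂ queueStep) (productLaw h0 h1 k0 k1) := by
  have a2 : 0 ≤ (l₂ : ℝ) := l₂.2.1
  have b2 : 0 ≤ 1 - (l₂ : ℝ) := sub_nonneg.2 l₂.2.2
  have hρ' : 0 ≤ 1 - ρ := sub_nonneg.2 k1.le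
  set π := productLaw h0 h1 k0 k1 with hπ
  -- Both sides are probability laws, so an inequality is enough, and it only needs a lower bound
  -- on the flow into each state.
  refine (pmf_eq_of_le fun s => ?_).symm
  obtain ⟨a, q⟩ := s
  obtain ⟨n, rfl⟩ : ∃ n : ℕ, a = n.succPNat := ⟨a.natPred, (PNat.succPNat_natPred a).symm⟩
  have hsucc : ∀ n : ℕ, nextAge n.succPNat false = (n + 1).succPNat := fun n => by
    simp [nextAge, ← PNat.coe_inj]
  rw [bind_kernel_apply]
  rcases n with _ | n
  · have e1 := tsum_le_map_apply π (φ := fun s => queueStep s ⟨true, true⟩)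
      (t := ⟨(0 : ℕ).succPNat, q⟩) (injective_queueState q) fun n => by
        simp [queueStep, nextAge]; rfl
    have e2 := tsum_le_map_apply π (φ := fun s => queueStep s ⟨false, true⟩)
      (t := ⟨(0 : ℕ).succPNat, q⟩) (injective_queueState (q + 1)) fun n => by
        simp [queueStep, nextAge]; rfl
    simp only [hπ, tsum_productLaw] at e1 e2
    refine le_trans (le_of_eq ?_) (le_trans
      (add_le_add (mul_le_mul_right e1 (slotLaw l₁ l₂ ⟨true, true⟩))
        (mul_le_mul_right e2 (slotLaw l₁ l₂ ⟨false, true⟩))) ?_)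
    · rw [productLaw_apply]
      simp only [slotLaw_apply, coin_true, coin_false, geometric_apply]
      rw [← ENNReal.ofReal_mul (by positivity), ← ENNReal.ofReal_mul (by positivity),
        ← ENNReal.ofReal_mul (by positivity), ← ENNReal.ofReal_mul (by positivity),
        ← ENNReal.ofReal_mul (by positivity), ← ENNReal.ofReal_add (by positivity) (by positivity)]
      congr 1
      linear_combination (1 - ρ) * ρ ^ q * hρ
    · exact add_le_add (le_self_add) le_rfl |>.trans le_self_add
  rcases q with _ | q
  · have e1 := apply_le_map_apply π (φ := fun s => queueStep s ⟨false, true⟩)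
      (s := ⟨n.succPNat, 0⟩) (t := ⟨(n + 1).succPNat, 0⟩) (by simp [queueStep, hsucc])
    have e2 := apply_le_map_apply π (φ := fun s => queueStep s ⟨false, false⟩)
      (s := ⟨n.succPNat, 0⟩) (t := ⟨(n + 1).succPNat, 0⟩) (by simp [queueStep, hsucc])
    refine le_trans (le_of_eq ?_) (le_trans
      (add_le_add (mul_le_mul_right e1 (slotLaw l₁ l₂ ⟨false, true⟩))
        (mul_le_mul_right e2 (slotLaw l₁ l₂ ⟨false, false⟩)))
      (add_le_add le_add_self le_rfl))
    rw [hπ, productLaw_apply, productLaw_apply]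
    simp only [slotLaw_apply, coin_true, coin_false, geometric_apply]
    rw [← ENNReal.ofReal_mul (by positivity), ← ENNReal.ofReal_mul (by positivity),
      ← ENNReal.ofReal_mul (by positivity), ← ENNReal.ofReal_mul (by positivity),
      ← ENNReal.ofReal_mul (by positivity), ← ENNReal.ofReal_mul (by positivity),
      ← ENNReal.ofReal_add (by positivity) (by positivity)]
    congr 1
    ring
  · have e1 := apply_le_map_apply π (φ := fun s => queueStep s ⟨true, false⟩)
      (s := ⟨n.succPNat, q⟩) (t := ⟨(n + 1).succPNat, q + 1⟩) (by simp [queueStep, hsucc])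
    have e2 := apply_le_map_apply π (φ := fun s => queueStep s ⟨false, false⟩)
      (s := ⟨n.succPNat, q + 1⟩) (t := ⟨(n + 1).succPNat, q + 1⟩) (by simp [queueStep, hsucc])
    refine le_trans (le_of_eq ?_) (le_trans
      (add_le_add (mul_le_mul_right e1 (slotLaw l₁ l₂ ⟨true, false⟩))
        (mul_le_mul_right e2 (slotLaw l₁ l₂ ⟨false, false⟩)))
      (add_le_add (le_add_self.trans le_self_add) le_rfl))
    rw [hπ, productLaw_apply, productLaw_apply, productLaw_apply]
    simp only [slotLaw_apply, coin_true, coin_false, geometric_apply]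
    rw [← ENNReal.ofReal_mul (by positivity), ← ENNReal.ofReal_mul (by positivity),
      ← ENNReal.ofReal_mul (by positivity), ← ENNReal.ofReal_mul (by positivity),
      ← ENNReal.ofReal_mul (by positivity), ← ENNReal.ofReal_mul (by positivity),
      ← ENNReal.ofReal_mul (by positivity),
      ← ENNReal.ofReal_add (by positivity) (by positivity)]
    congr 1
    linear_combination (-(l₁ : ℝ) * (1 - l₁) ^ n * (1 - ρ) * ρ ^ q) * hρ

/-- Slots with an opportunity and no arrival empty the queue, so that the empty queue right after an
actuation can be reached from every state. -/
theorem queue_accessible (h₁ : 0 < (l₁ : ℝ)) (h₂ : 0 < (l₂ : ℝ)) (h₁' : (l₁ : ℝ) < 1)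
    (s : QueueState) : ∃ n, lawAt (kernel l₁ l₂ queueStep) s n ⟨1, 0⟩ ≠ 0 := by
  have hempty : ∀ (q : ℕ) (a : ℕ+), ((List.replicate q ⟨false, true⟩).foldl queueStep
      (⟨a, q⟩ : QueueState)).length = 0 := by
    intro q
    induction q with
    | zero => exact fun _ => rfl
    | succ q ih =>
      intro a
      rw [List.replicate_succ, List.foldl_cons]
      exact ih _
  let es : List Slot := List.replicate s.length ⟨false, true⟩ ++ [⟨true, true⟩]
  have hes : ∀ e ∈ es, slotLaw l₁ l₂ e ≠ 0 := by
    intro e he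
    rcases List.mem_append.1 he with he | he
    · rw [(List.mem_replicate.1 he).2]
      exact slotLaw_ne_zero (coin_false_ne_zero h₁') (coin_true_ne_zero h₂)
    · rw [List.mem_singleton.1 he]
      exact slotLaw_ne_zero (coin_true_ne_zero h₁) (coin_true_ne_zero h₂)
  have hend : es.foldl queueStep s = ⟨1, 0⟩ := by
    simp only [es, List.foldl_append, List.foldl_cons, List.foldl_nil]
    have := hempty s.length s.age
    simp [queueStep, nextAge, this]
  exact ⟨es.length, hend ▸ lawAt_ne_zero_of_word hes s⟩

theorem queue_hasStationaryAverage (h₁ : 0 < (l₁ : ℝ)) (h₂ : 0 < (l₂ : ℝ))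
    (hlt : (l₁ : ℝ) < l₂) :
    HasStationaryAverage (kernel l₁ l₂ queueStep) QueueState.age
      (ENNReal.ofReal (1 / (l₁ : ℝ))) := by
  have hx : (l₁ : ℝ) < 1 := hlt.trans_le l₂.2.2
  have hx' : 0 < 1 - (l₁ : ℝ) := sub_pos.2 hx
  have hy : 0 ≤ 1 - (l₂ : ℝ) := sub_nonneg.2 l₂.2.2
  have hd : 0 < (l₂ : ℝ) * (1 - l₁) := mul_pos h₂ hx'
  have k0 : 0 ≤ (l₁ : ℝ) * (1 - l₂) / (l₂ * (1 - l₁)) := by positivity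
  have k1 : (l₁ : ℝ) * (1 - l₂) / (l₂ * (1 - l₁)) < 1 := by
    rw [div_lt_one hd]
    linarith
  have hst := isStationary_productLaw (l₂ := l₂) h₁ hx'.le (sub_lt_self 1 h₁) k0 k1
    (mul_div_cancel₀ _ hd.ne').symm
  have huniq : ∀ π, IsStationary (kernel l₁ l₂ queueStep) π → π = _ := fun π hπ =>
    IsStationary.unique_of_accessible (queue_accessible h₁ h₂ hx) hπ hst
  refine ⟨⟨_, hst, huniq⟩, fun π hπ => ?_⟩
  rw [huniq π hπ, mean_productLaw, sub_sub_cancel]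

end AgeOfActuation

theorem theorem1 (l₁ l₂ : unitInterval) (h₁ : 0 < (l₁ : ℝ)) (h₂ : 0 < (l₂ : ℝ)) :
    -- (i) infinite queue with a controller, in the stable regime
    ((l₁ : ℝ) < (l₂ : ℝ) →
      AgeOfActuation.HasStationaryAverage
        (AgeOfActuation.kernel l₁ l₂ AgeOfActuation.queueStep)
        AgeOfActuation.QueueState.age (ENNReal.ofReal (1 / (l₁ : ℝ))) ∧
      ∀ p : AgeOfActuation.Policy,
        (∀ s : AgeOfActuation.PacketState,
          (AgeOfActuation.kernel l₁ l₂ (AgeOfActuation.packetStep p) s).map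
              AgeOfActuation.PacketState.count =
            AgeOfActuation.kernel l₁ l₂ AgeOfActuation.queueStep s.count) ∧
        AgeOfActuation.HasLongRunAverage
          (AgeOfActuation.kernel l₁ l₂ (AgeOfActuation.packetStep p))
          AgeOfActuation.PacketState.age (ENNReal.ofReal (1 / (l₁ : ℝ)))) ∧
    -- (ii) single-packet buffer with a controller
    (∀ v : ℝ, v = (((l₂ : ℝ) - 1) * ((l₁ : ℝ) ^ 2 + (l₁ : ℝ) * (l₂ : ℝ)) - (l₂ : ℝ) ^ 2) /
        ((l₁ : ℝ) * (l₂ : ℝ) * ((l₁ : ℝ) * ((l₂ : ℝ) - 1) - (l₂ : ℝ))) →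
      AgeOfActuation.HasStationaryAverage
        (AgeOfActuation.kernel l₁ l₂ AgeOfActuation.bufferStep)
        AgeOfActuation.BufferState.age (ENNReal.ofReal v) ∧
      AgeOfActuation.HasLongRunAverage
        (AgeOfActuation.kernel l₁ l₂ AgeOfActuation.bufferStep)
        AgeOfActuation.BufferState.age (ENNReal.ofReal v)) ∧
    -- (iii) single-packet buffer with a unit battery
    (¬ ((l₁ : ℝ) = 1 ∧ (l₂ : ℝ) = 1) →
      ∀ v : ℝ, v = ((l₁ : ℝ) ^ 4 * ((l₂ : ℝ) - 1) ^ 3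
          - 2 * (l₁ : ℝ) ^ 3 * (l₂ : ℝ) * ((l₂ : ℝ) - 1) ^ 2
          - (l₁ : ℝ) ^ 2 * (l₂ : ℝ) ^ 2 * (2 * (l₂ : ℝ) ^ 2 - 3 * (l₂ : ℝ) + 1)
          + (l₁ : ℝ) * (l₂ : ℝ) ^ 3 * (3 * (l₂ : ℝ) - 2) - (l₂ : ℝ) ^ 4) /
        ((l₁ : ℝ) * (l₂ : ℝ) * ((l₁ : ℝ) * ((l₂ : ℝ) - 1) - (l₂ : ℝ)) *
          ((l₁ : ℝ) ^ 2 * ((l₂ : ℝ) - 1) ^ 2 + (l₁ : ℝ) * (-2 * (l₂ : ℝ) ^ 2 + (l₂ : ℝ))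
            + (l₂ : ℝ) ^ 2)) →
      AgeOfActuation.HasStationaryAverage
        (AgeOfActuation.kernel l₁ l₂ AgeOfActuation.batteryStep)
        AgeOfActuation.BatteryState.age (ENNReal.ofReal v) ∧
      AgeOfActuation.HasLongRunAverage
        (AgeOfActuation.kernel l₁ l₂ AgeOfActuation.batteryStep)
        AgeOfActuation.BatteryState.age (ENNReal.ofReal v)) := by
  refine ⟨fun hlt => ⟨AgeOfActuation.queue_hasStationaryAverage h₁ h₂ hlt, fun p =>
      ⟨fun s => AgeOfActuation.map_kernel (φ := AgeOfActuation.PacketState.count)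
        (AgeOfActuation.count_packetStep p) s, ?_⟩⟩,
    fun v hv => AgeOfActuation.buffer_averages h₁ h₂ hv,
    fun h v hv => AgeOfActuation.battery_averages h₁ h₂ h hv⟩
  exact AgeOfActuation.hasLongRunAverage_of_queue (φ := AgeOfActuation.PacketState.count) h₁ h₂ hlt
    (AgeOfActuation.count_packetStep p)
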